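/- Let $L$ be a first-order language, $T$ a complete $L$-theory, and $\varphi(\overline{x};\overline{y})$ a partitioned $L$-formula (without parameters). All parameter tuples below lie in a monster model of $T$ (equivalently, in arbitrary models of $T$). Write $\theta^1=\theta$ and $\theta^0=\neg\theta$. A set $B$ of $\mathrm{lg}(\overline{y})$-tuples is $\varphi$-independent if $\{\varphi(\overline{x};\overline{b})^{s(\overline{b})} : \overline{b}\in B\}$ is consistent for every $s:B\to\{0,1\}$; $\varphi$ is dependent (NIP) if there is a largest $N<\omega$ such that some $\varphi$-independent set has size $N$. A $\varphi$-type over $B$ is a consistent set of formulas $\varphi(\overline{x};\overline{b})^t$, $t\in\{0,1\}$, in which $\overline{b}$ ranges over all of $B$; $S_\varphi(B)$ is the set of these. For a partial order $(P;\unlhd)$, a sequence $\langle \overline{b}_i : i\in P\rangle$ of tuples of the same finite length is indiscernible if for every $n$, all distinct $i_0,\dots,i_n\in P$ and all distinct $j_0,\dots,j_n\in P$ with the same quantifier-free type in $(P;\unlhd)$ (that is, $i_k\unlhd i_\ell \Leftrightarrow j_k\unlhd j_\ell$ for all $k,\ell\le n$), the tuples $(\overline{b}_{i_0},\dots,\overline{b}_{i_n})$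 and $(\overline{b}_{j_0},\dots,\overline{b}_{j_n})$ satisfy the same $L$-formulas. **Theorem 1.1.** The following are equivalent: (i) $\varphi$ is dependent; (ii) there exist $n<\omega$ and an $L$-formula $\psi(\overline{y};\overline{z}_0,\dots,\overline{z}_{n-1})$, with each $\overline{z}_r$ of length $\mathrm{lg}(\overline{y})$, such that for all finite partial orders $(P;\unlhd)$, all indiscernible sequences $\langle \overline{b}_i : i\in P\rangle$ of $\mathrm{lg}(\overline{y})$-tuples for which the set $\{\overline{b}_i : i\in P\}$ has at least two elements, and all types $p\in S_\varphi(\{\overline{b}_i : i\in P\})$, there exist $i_0,\dots,i_{n-1}\in P$ such that for all $i\in P$, $$\varphi(\overline{x};\overline{b}_i)\in p \iff\ \models \psi(\overline{b}_i;\overline{b}_{i_0},\dots,\overline{b}_{i_{n-1}}).$$ -/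

import Mathlib

open FirstOrder

universe u v w u' v' w'

namespace POIndisc

section Types

variable {L : FirstOrder.Language.{u, v}} {M : Type w} [L.Structure M] {k m : ℕ}

/-- Let `φ(x̄; ȳ)` be a partitioned formula, with `x̄` of length `k` and `ȳ` of length `m`.
A pair `(b, t)` with `b` an `m`-tuple of `M` and `t` a truth value stands for the formula
`φ(x̄; b)^t`, that is `φ(x̄; b)` when `t` is true and `¬ φ(x̄; b)` when `t` is false.
A set `p` of such formulas is consistent if some tuple of some elementary extension of `M`
satisfies all of them. -/
def IsConsistent (φ : L.Formula (Fin k ⊕ Fin m)) (p : Set ((Fin m → M) × Bool)) : Prop :=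
  ∃ (N : Type w) (_ : L.Structure N) (e : M ↪ₑ[L] N) (a : Fin k → N),
    ∀ c ∈ p, (φ.Realize (Sum.elim a (e ∘ c.1)) ↔ c.2 = true)

/-- The space `S_φ(B)` of `φ`-types with domain `B`: consistent sets of formulas `φ(x̄; b)^t`
in which `b` ranges over all of `B`. -/
def typeSpace (φ : L.Formula (Fin k ⊕ Fin m)) (B : Set (Fin m → M)) :
    Set (Set ((Fin m → M) × Bool)) :=
  {p | (∀ b, (∃ t, (b, t) ∈ p) ↔ b ∈ B) ∧ IsConsistent φ p}

/-- `B` is `φ`-independent: for every `s : B → 2` the set `{φ(x̄; b)^{s(b)} : b ∈ B}` is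
consistent. -/
def IsIndependent (φ : L.Formula (Fin k ⊕ Fin m)) (B : Set (Fin m → M)) : Prop :=
  ∀ s : B → Bool, IsConsistent φ (Set.range fun b : B => ((b : Fin m → M), s b))

end Types

/-- `ID(φ) = N` in the complete theory `T`: `N` is the largest size of a `φ`-independent set of
parameter tuples. Parameters come from arbitrary models of `T`, i.e. from arbitrary small elementary
submodels of a monster model. -/
def HasIndependenceDimension {L : FirstOrder.Language.{u, v}} (T : L.Theory) {k m : ℕ}
    (φ : L.Formula (Fin k ⊕ Fin m)) (N : ℕ) : Prop :=
  IsGreatest {d : ℕ | ∃ (M : FirstOrder.Language.Theory.ModelType.{u, v, max u v w} T)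
    (B : Set (Fin m → M)), B.encard = d ∧ IsIndependent φ B} N

/-- `φ` is dependent (NIP) in `T`: its independence dimension is finite. -/
def IsDependent {L : FirstOrder.Language.{u, v}} (T : L.Theory) {k m : ℕ}
    (φ : L.Formula (Fin k ⊕ Fin m)) : Prop :=
  ∃ N : ℕ, HasIndependenceDimension.{u, v, w} T φ N

section Indiscernibles

/-- The tuples `i` and `j` of the `S`-structure `P` have the same quantifier-free type. -/
def SameQFType (S : FirstOrder.Language.{u', v'}) {P : Type w'} [S.Structure P] {n : ℕ}
    (i j : Fin n → P) :
    Prop :=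
  ∀ θ : S.Formula (Fin n), θ.IsQF → (θ.Realize i ↔ θ.Realize j)

variable {L : FirstOrder.Language.{u, v}} {M : Type w} [L.Structure M] {m : ℕ}

/-- Let `Δ` be a set of `L`-formulas in variables `z̄_0, …, z̄_n`, each of length `m`.
The sequence `⟨b_i : i ∈ P⟩` of `m`-tuples, indexed by the `S`-structure `P`, is
`Δ`-indiscernible if `tp_Δ(b_{i_0}, …, b_{i_n})` depends, for distinct `i_0, …, i_n`, only on the
quantifier-free type of `(i_0, …, i_n)` in `P`. -/
def IsIndiscernibleFor (S : FirstOrder.Language.{u', v'}) {P : Type w'} [S.Structure P] {n : ℕ}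
    (Δ : Set (L.Formula (Fin (n + 1) × Fin m))) (b : P → Fin m → M) : Prop :=
  ∀ i j : Fin (n + 1) → P, Function.Injective i → Function.Injective j → SameQFType S i j →
    ∀ δ ∈ Δ, (δ.Realize (fun q => b (i q.1) q.2) ↔ δ.Realize (fun q => b (j q.1) q.2))

variable (L) in
/-- The sequence is (generalized) indiscernible: `Δ`-indiscernible for all `Δ`. -/
def IsIndiscernible (S : FirstOrder.Language.{u', v'}) {P : Type w'} [S.Structure P]
    (b : P → Fin m → M) :
    Prop :=
  ∀ (n : ℕ) (Δ : Set (L.Formula (Fin (n + 1) × Fin m))), IsIndiscernibleFor S Δ b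

variable (L) in
/-- Indiscernibility with respect to a partial order, seen as a structure in the language whose only
symbol is a binary relation interpreted as `≤`. -/
def IsPartialOrderIndiscernible {P : Type w'} [PartialOrder P] (b : P → Fin m → M) : Prop :=
  letI : FirstOrder.Language.order.Structure P := FirstOrder.Language.orderStructure P
  IsIndiscernible L FirstOrder.Language.order b

end Indiscernibles

end POIndisc

/-! If `φ` is dependent, the sets that its instances trace on any finite family of parameters have
VC dimension bounded by the independence dimension, so the direction from (i) to (ii) becomes a
statement about finite set families. Call a member teachable if boundedly many of its labelled
points single it out. In a family of bounded VC dimension every member is the pointwise majority of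
boundedly many teachable members (`exists_majority_of_teachable`). For this, a bounded sample of
points with the labels of `c` forces a member to be close to `c` for a given weight, and
`Finset.exists_isTeachingSet` finds a teachable one among those left. Minimax then mixes teachable
members so that each point is correct with weight at least 2/3, and sampling from the mixture leaves
boundedly many. A teachable member is defined by an existential formula over its teaching points,
and a label is coded by whether two parameters are equal, which is why two distinct tuples are
needed. Hence a single `ψ` serves all types.

Conversely, if `φ` is independent, an ultraproduct along an iterated ultrafilter gives, for each
`K`, an indiscernible sequence of length `K` on which all `2 ^ K` patterns occur
(`exists_indiscernible_pattern`). A formula `ψ` with `n` parameter tuples defines at most `K ^ n` of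
them, which is too few for large `K`. -/

/-! ### VC dimension under pullback, and a polynomial Sauer–Shelah bound. -/

section VCDimension

open Finset

variable {α H : Type*} [DecidableEq α] [DecidableEq H]

/-- Two indices of the same point cannot be separated, so a shattered index set has no repetitions.
Sampling with repetition therefore does not raise the dimension. -/
theorem Finset.Shatters.of_image_filter_mem [Fintype α] {𝒜 : Finset (Finset H)} {w : α → H}
    {s : Finset α} (hs : (𝒜.image fun A => univ.filter fun a => w a ∈ A).Shatters s) :
    Set.InjOn w s ∧ 𝒜.Shatters (s.image w) := by
  have key : ∀ t ⊆ s, ∃ A ∈ 𝒜, ∀ a ∈ s, w a ∈ A ↔ a ∈ t := by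
    intro t ht
    obtain ⟨u, hu, hut⟩ := hs ht
    obtain ⟨A, hA, rfl⟩ := mem_image.1 hu
    refine ⟨A, hA, fun a ha => ?_⟩
    rw [← hut]
    simp [ha]
  constructor
  · intro a ha b hb hab
    obtain ⟨A, -, h⟩ := key {a} (by simpa using ha)
    have h1 := (h a ha).2 (mem_singleton_self a)
    rw [hab] at h1
    exact (mem_singleton.1 ((h b hb).1 h1)).symm
  · intro t ht
    obtain ⟨A, hA, h⟩ := key (s.filter fun a => w a ∈ t) (filter_subset _ _)
    refine ⟨A, hA, ?_⟩
    ext x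
    constructor
    · intro hx
      obtain ⟨hx1, hx2⟩ := mem_inter.1 hx
      obtain ⟨a, ha, rfl⟩ := mem_image.1 hx1
      exact (mem_filter.1 ((h a ha).1 hx2)).2
    · intro hx
      obtain ⟨a, ha, rfl⟩ := mem_image.1 (ht hx)
      exact mem_inter.2 ⟨ht hx, (h a ha).2 (mem_filter.2 ⟨ha, hx⟩)⟩

theorem Finset.vcDim_le_iff {𝒜 : Finset (Finset α)} {d : ℕ} :
    𝒜.vcDim ≤ d ↔ ∀ s, 𝒜.Shatters s → #s ≤ d := by
  simp [vcDim]

theorem Finset.vcDim_image_filter_mem_le [Fintype α] (𝒜 : Finset (Finset H)) (w : α → H) :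
    (𝒜.image fun A => univ.filter fun a => w a ∈ A).vcDim ≤ 𝒜.vcDim := by
  rw [vcDim_le_iff]
  intro s hs
  obtain ⟨h1, h2⟩ := hs.of_image_filter_mem
  rw [← card_image_of_injOn h1]
  exact h2.card_le_vcDim

/-- Sauer–Shelah with each binomial coefficient bounded by a power; the `+ 1` in the base keeps it
positive, so that powers grow with the exponent. -/
theorem Finset.card_le_of_vcDim_le [Fintype α] {𝒜 : Finset (Finset α)} {d : ℕ}
    (h : 𝒜.vcDim ≤ d) : #𝒜 ≤ (d + 1) * (Fintype.card α + 1) ^ d := by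
  refine (card_le_card_shatterer 𝒜).trans (card_shatterer_le_sum_vcDim.trans ?_)
  calc ∑ k ∈ Iic 𝒜.vcDim, (Fintype.card α).choose k
      ≤ ∑ k ∈ Iic 𝒜.vcDim, (Fintype.card α + 1) ^ d := by
        refine sum_le_sum fun k hk => ?_
        refine (Nat.choose_le_pow _ _).trans ?_
        refine (Nat.pow_le_pow_left (Nat.le_succ _) k).trans ?_
        exact Nat.pow_le_pow_right (Nat.succ_pos _) ((mem_Iic.1 hk).trans h)
    _ = (𝒜.vcDim + 1) * (Fintype.card α + 1) ^ d := by simp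
    _ ≤ _ := by gcongr

end VCDimension

/-! ### Uniform law of large numbers by symmetrization. -/

section Sampling

open Finset

variable {H : Type*} [DecidableEq H]

/-- The traces of a set family on a double sample. -/
def Finset.doubleTraces (𝒜 : Finset (Finset H)) {T : ℕ} (W : Fin T → H × H) :
    Finset (Fin T → Bool × Bool) :=
  𝒜.image fun A t => (decide ((W t).1 ∈ A), decide ((W t).2 ∈ A))

theorem Finset.card_doubleTraces_le {𝒜 : Finset (Finset H)} {d : ℕ} (h : 𝒜.vcDim ≤ d) {T : ℕ}
    (W : Fin T → H × H) : #(𝒜.doubleTraces W) ≤ (d + 1) * (2 * T + 1) ^ d := by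
  let w : Fin T × Bool → H := fun a => if a.2 then (W a.1).1 else (W a.1).2
  let ι : (Fin T → Bool × Bool) → Finset (Fin T × Bool) := fun v =>
    univ.filter fun a => (if a.2 then (v a.1).1 else (v a.1).2) = true
  have hι : Function.Injective ι := by
    intro v v' hv
    have hm : ∀ a, a ∈ ι v ↔ a ∈ ι v' := fun a => by rw [hv]
    funext t
    have h1 := hm (t, true)
    have h2 := hm (t, false)
    simp only [ι, mem_filter, mem_univ, true_and, if_true] at h1 h2
    ext
    · exact Bool.eq_iff_iff.2 h1
    · exact Bool.eq_iff_iff.2 (by simpa using h2)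
  rw [← card_image_of_injective _ hι]
  have himg : (𝒜.doubleTraces W).image ι = 𝒜.image fun A => univ.filter fun a => w a ∈ A := by
    rw [doubleTraces, image_image]
    refine image_congr fun A _ => ?_
    ext ⟨t, b⟩
    cases b <;> simp [ι, w]
  rw [himg]
  refine (card_le_of_vcDim_le ((vcDim_image_filter_mem_le 𝒜 w).trans h)).trans (le_of_eq ?_)
  simp [mul_comm]

/-- Exchange the two entries of those pairs that are selected by `σ`. -/
def swapAt {ι X : Type*} (σ : ι → Bool) (W : ι → X × X) : ι → X × X := fun t =>
  if σ t then (W t).swap else W t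

theorem swapAt_involutive {ι X : Type*} (σ : ι → Bool) :
    Function.Involutive (swapAt σ : (ι → X × X) → ι → X × X) := by
  intro W
  funext t
  by_cases h : σ t <;> simp [swapAt, h]

theorem Finset.doubleTraces_swapAt (𝒜 : Finset (Finset H)) {T : ℕ} (σ : Fin T → Bool)
    (W : Fin T → H × H) :
    𝒜.doubleTraces (swapAt σ W) = (𝒜.doubleTraces W).image (swapAt σ) := by
  rw [doubleTraces, doubleTraces, image_image]
  refine image_congr fun A _ => ?_
  funext t
  by_cases h : σ t <;> simp [swapAt, h]

/-- The sign-symmetric difference of the two entries of a pair of truth values. -/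
def boolDiff (p : Bool × Bool) : ℝ := (if p.2 then 1 else 0) - (if p.1 then 1 else 0)

theorem boolDiff_swap (p : Bool × Bool) : boolDiff p.swap = -boolDiff p := by
  simp [boolDiff]

theorem boolDiff_sq_le (p : Bool × Bool) : boolDiff p ^ 2 ≤ 1 := by
  rcases p with ⟨_ | _, _ | _⟩ <;> norm_num [boolDiff]

/-- The sum over independent swaps factors over the coordinates into terms `2 * cosh`, and `cosh x ≤
exp (x ^ 2 / 2)`. -/
theorem sum_swapAt_exp_boolDiff_le {T : ℕ} (c : ℝ) (v : Fin T → Bool × Bool) :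
    ∑ σ : Fin T → Bool, ∏ t, Real.exp (c * boolDiff (swapAt σ v t)) ≤
      (2 * Real.exp (c ^ 2 / 2)) ^ T := by
  have h1 : ∑ σ : Fin T → Bool, ∏ t, Real.exp (c * boolDiff (swapAt σ v t)) =
      ∏ t, ∑ b : Bool, Real.exp (c * boolDiff (if b then (v t).swap else v t)) := by
    rw [Finset.prod_univ_sum, Fintype.piFinset_univ]
    rfl
  rw [h1]
  calc _ ≤ ∏ _t : Fin T, (2 * Real.exp (c ^ 2 / 2)) := by
        refine prod_le_prod (fun t _ => sum_nonneg fun b _ => (Real.exp_pos _).le) fun t _ => ?_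
        have h2 : ∑ b : Bool, Real.exp (c * boolDiff (if b then (v t).swap else v t)) =
            2 * Real.cosh (c * boolDiff (v t)) := by
          rw [Fintype.sum_bool, Real.cosh_eq]
          simp only [if_true, boolDiff_swap, Bool.false_eq_true, if_false]
          ring_nf
        rw [h2]
        refine mul_le_mul_of_nonneg_left ((Real.cosh_le_exp_half_sq _).trans ?_) (by norm_num)
        refine Real.exp_le_exp.2 ?_
        have := mul_le_mul_of_nonneg_left (boolDiff_sq_le (v t)) (sq_nonneg c)
        rw [mul_pow]
        linarith
    _ = _ := by simp

theorem exp_mul_sum_le_sum_mul_exp {Y : Type*} [Fintype Y] {ν : Y → ℝ} (hν : ∀ h, 0 ≤ ν h) (hν1 : ∑ h, ν h = 1)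
    (f : Y → ℝ) : Real.exp (∑ h, ν h * f h) ≤ ∑ h, ν h * Real.exp (f h) := by
  simpa using convexOn_exp.map_sum_le (t := univ) (w := ν) (p := f) (fun h _ => hν h) hν1
    (fun h _ => Set.mem_univ _)

theorem sum_prod_eq_one {ι : Type*} [Fintype ι] [DecidableEq ι] {Y : Type*} [Fintype Y]
    {ν : Y → ℝ} (h : ∑ y, ν y = 1) : ∑ S : ι → Y, ∏ t, ν (S t) = 1 := by
  have := Finset.prod_univ_sum (fun _ : ι => (univ : Finset Y)) (fun _ y => ν y)
  rw [Fintype.piFinset_univ] at this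
  rw [← this]
  simp [h]

variable [Fintype H]

/-- The product weight on double samples is invariant under swaps, so the sum may be averaged over
all `σ`. For fixed `W` the average is taken trace by trace, and there are only polynomially many
traces. -/
theorem sum_doubleTraces_exp_le {𝒜 : Finset (Finset H)} {d : ℕ} (h𝒜 : 𝒜.vcDim ≤ d)
    {ν : H → ℝ} (hν : ∀ h, 0 ≤ ν h) (hν1 : ∑ h, ν h = 1) (T : ℕ) (c : ℝ) :
    ∑ W : Fin T → H × H, (∏ t, ν (W t).1 * ν (W t).2) *
        ∑ v ∈ 𝒜.doubleTraces W, ∏ t, Real.exp (c * boolDiff (v t)) ≤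
      (d + 1) * (2 * T + 1) ^ d * Real.exp (c ^ 2 / 2) ^ T := by
  set F : (Fin T → H × H) → ℝ := fun W =>
    ∑ v ∈ 𝒜.doubleTraces W, ∏ t, Real.exp (c * boolDiff (v t)) with hF
  set p : (Fin T → H × H) → ℝ := fun W => ∏ t, ν (W t).1 * ν (W t).2 with hp
  have hp0 : ∀ W, 0 ≤ p W := fun W => prod_nonneg fun t _ => mul_nonneg (hν _) (hν _)
  have hp1 : ∑ W, p W = 1 := by
    refine sum_prod_eq_one (ν := fun y : H × H => ν y.1 * ν y.2) ?_
    rw [Fintype.sum_prod_type, ← Finset.sum_mul_sum, hν1, one_mul]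
  have hswap : ∀ σ, ∑ W, p W * F W = ∑ W, p W * F (swapAt σ W) := by
    intro σ
    refine Fintype.sum_equiv (swapAt_involutive σ).toPerm _ _ fun W => ?_
    simp only [Function.Involutive.coe_toPerm]
    rw [swapAt_involutive σ W]
    congr 1
    refine prod_congr rfl fun t _ => ?_
    by_cases h : σ t <;> simp [swapAt, h, mul_comm]
  have hFs : ∀ σ W, F (swapAt σ W) =
      ∑ v ∈ 𝒜.doubleTraces W, ∏ t, Real.exp (c * boolDiff (swapAt σ v t)) := by
    intro σ W
    rw [hF]
    simp only
    rw [doubleTraces_swapAt, sum_image fun x _ y _ h => (swapAt_involutive σ).injective h]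
  have hbound : ∀ W, ∑ σ : Fin T → Bool, F (swapAt σ W) ≤
      ((d + 1) * (2 * T + 1) ^ d) * (2 * Real.exp (c ^ 2 / 2)) ^ T := by
    intro W
    simp_rw [hFs]
    rw [sum_comm]
    refine (sum_le_sum fun v _ => sum_swapAt_exp_boolDiff_le c v).trans ?_
    rw [sum_const, nsmul_eq_mul]
    refine mul_le_mul_of_nonneg_right ?_ (by positivity)
    exact_mod_cast card_doubleTraces_le h𝒜 W
  have h2T : (2 : ℝ) ^ T * ∑ W, p W * F W = ∑ W, p W * ∑ σ : Fin T → Bool, F (swapAt σ W) := by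
    simp_rw [mul_sum]
    rw [sum_comm]
    have : ∀ σ : Fin T → Bool, ∑ W, p W * F (swapAt σ W) = ∑ W, p W * F W := fun σ =>
      (hswap σ).symm
    rw [sum_congr rfl fun σ _ => this σ]
    simp [mul_sum]
  have h3 : (2 : ℝ) ^ T * ∑ W, p W * F W ≤
      2 ^ T * (((d + 1) * (2 * T + 1) ^ d) * Real.exp (c ^ 2 / 2) ^ T) := by
    rw [h2T]
    calc _ ≤ ∑ W, p W * (((d + 1) * (2 * T + 1) ^ d) * (2 * Real.exp (c ^ 2 / 2)) ^ T) :=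
          sum_le_sum fun W _ => mul_le_mul_of_nonneg_left (hbound W) (hp0 W)
      _ = _ := by
          rw [← sum_mul, hp1, mul_pow]
          ring
  exact le_of_mul_le_mul_left h3 (by positivity)

theorem exists_sample_size (d : ℕ) {δ : ℝ} (hδ : 0 < δ) :
    ∃ T : ℕ, 0 < T ∧ ((d + 1) * (2 * T + 1) ^ d : ℝ) < Real.exp (δ ^ 2 / 2 * T) := by
  have h1 : Filter.Tendsto (fun x : ℝ => Real.exp x / x ^ d) Filter.atTop Filter.atTop :=
    Real.tendsto_exp_div_pow_atTop d
  set c := δ ^ 2 / 2 with hc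
  have hc0 : 0 < c := by positivity
  have h2 : Filter.Tendsto (fun T : ℕ => c * (T : ℝ)) Filter.atTop Filter.atTop :=
    tendsto_natCast_atTop_atTop.const_mul_atTop hc0
  -- The threshold comes from `(2T + 1) ^ d ≤ (3T) ^ d = (3 / c) ^ d * (c T) ^ d`.
  obtain ⟨T, hT, hT0⟩ := ((h1.comp h2).eventually_gt_atTop
    ((d + 1) * (3 / c) ^ d) |>.and (Filter.eventually_gt_atTop 0)).exists
  refine ⟨T, hT0, ?_⟩
  have hT' : (1 : ℝ) ≤ T := by exact_mod_cast hT0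
  simp only [Function.comp] at hT
  rw [lt_div_iff₀ (by positivity)] at hT
  calc ((d + 1) * (2 * T + 1) ^ d : ℝ) ≤ (d + 1) * (3 * T) ^ d := by
        gcongr; linarith
    _ = (d + 1) * (3 / c) ^ d * (c * T) ^ d := by
        rw [mul_assoc, ← mul_pow]
        congr 2
        field_simp
    _ < _ := hT

/-- Uniform law of large numbers for families of bounded VC dimension: the size of the sample
depends on the dimension and the precision only. -/
theorem exists_uniform_sample (d : ℕ) {δ : ℝ} (hδ : 0 < δ) :
    ∃ T : ℕ, 0 < T ∧ ∀ {H : Type w} [DecidableEq H] [Fintype H] (𝒜 : Finset (Finset H)) (ν : H → ℝ),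
      𝒜.vcDim ≤ d → (∀ h, 0 ≤ ν h) → ∑ h, ν h = 1 →
      ∃ S : Fin T → H, ∀ A ∈ 𝒜, T * ((∑ h ∈ A, ν h) - δ) ≤ #(univ.filter fun t => S t ∈ A) := by
  obtain ⟨T, hT0, hT⟩ := exists_sample_size d hδ
  refine ⟨T, hT0, ?_⟩
  intro H _ _ 𝒜 ν h𝒜 hν hν1
  by_contra! hcon
  choose A hA hlt using hcon
  -- The sample `S` undercounts `A S` by more than `δ * T`. Jensen replaces the weight of `A S` by
  -- an average over a second sample `S'`, and the term of the single trace of `A S` is at most the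
  -- sum over all traces.
  have hpt : ∀ S : Fin T → H, Real.exp (δ ^ 2 * T) ≤
      ∑ S' : Fin T → H, (∏ t, ν (S' t)) * ∑ v ∈ 𝒜.doubleTraces (fun t => (S t, S' t)),
        ∏ t, Real.exp (δ * boolDiff (v t)) := by
    intro S
    let χ : H → ℝ := fun h => if h ∈ A S then 1 else 0
    have h1 : ∑ h, ν h * (δ * χ h) = δ * ∑ h ∈ A S, ν h := by
      simp [χ, mul_sum, mul_comm]
    have h2 : (∑ t, χ (S t)) = #(univ.filter fun t => S t ∈ A S) := by
      simp [χ]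
    calc Real.exp (δ ^ 2 * T)
        ≤ Real.exp (δ * ∑ h ∈ A S, ν h) ^ T * Real.exp (- δ * ∑ t, χ (S t)) := by
          rw [← Real.exp_nat_mul, ← Real.exp_add, Real.exp_le_exp, h2]
          nlinarith [hlt S]
      _ ≤ (∑ h, ν h * Real.exp (δ * χ h)) ^ T * Real.exp (- δ * ∑ t, χ (S t)) := by
          rw [← h1]
          gcongr
          exact exp_mul_sum_le_sum_mul_exp hν hν1 _
      _ = ∑ S' : Fin T → H, (∏ t, ν (S' t)) *
            ∏ t, Real.exp (δ * boolDiff (decide (S t ∈ A S), decide (S' t ∈ A S))) := by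
          have := Finset.prod_univ_sum (fun _ : Fin T => (univ : Finset H))
            (fun _ h => ν h * Real.exp (δ * χ h))
          rw [Fintype.piFinset_univ, prod_const, card_univ, Fintype.card_fin] at this
          rw [this, sum_mul]
          refine sum_congr rfl fun S' _ => ?_
          rw [prod_mul_distrib, mul_assoc]
          congr 1
          rw [mul_sum, Real.exp_sum, ← prod_mul_distrib]
          refine prod_congr rfl fun t _ => ?_
          rw [← Real.exp_add]
          congr 1
          simp only [χ, boolDiff, decide_eq_true_eq]
          ring
      _ ≤ _ := by
          refine sum_le_sum fun S' _ => mul_le_mul_of_nonneg_left ?_ (prod_nonneg fun t _ => hν _)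
          refine single_le_sum (f := fun v : Fin T → Bool × Bool =>
            ∏ t, Real.exp (δ * boolDiff (v t)))
            (fun v _ => prod_nonneg fun t _ => (Real.exp_pos _).le) ?_
          exact mem_image_of_mem (fun B t => (decide (S t ∈ B), decide (S' t ∈ B))) (hA S)
  have hsum : Real.exp (δ ^ 2 * T) ≤
      ∑ W : Fin T → H × H, (∏ t, ν (W t).1 * ν (W t).2) *
        ∑ v ∈ 𝒜.doubleTraces W, ∏ t, Real.exp (δ * boolDiff (v t)) := by
    rw [← Equiv.sum_comp (Equiv.arrowProdEquivProdArrow (Fin T) (fun _ => H) (fun _ => H)).symm,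
      Fintype.sum_prod_type]
    simp only [Equiv.arrowProdEquivProdArrow_symm_apply]
    calc Real.exp (δ ^ 2 * T) = ∑ S : Fin T → H, (∏ t, ν (S t)) * Real.exp (δ ^ 2 * T) := by
          rw [← sum_mul, sum_prod_eq_one hν1, one_mul]
      _ ≤ _ := sum_le_sum fun S _ =>
          mul_le_mul_of_nonneg_left (hpt S) (prod_nonneg fun t _ => hν _)
      _ = _ := by
          refine sum_congr rfl fun S _ => ?_
          rw [mul_sum]
          refine sum_congr rfl fun S' _ => ?_
          simp only [prod_mul_distrib, mul_assoc]
          rfl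
  have hle := hsum.trans (sum_doubleTraces_exp_le h𝒜 hν hν1 T δ)
  have hexp : Real.exp (δ ^ 2 * T) = Real.exp (δ ^ 2 / 2 * T) * Real.exp (δ ^ 2 / 2) ^ T := by
    rw [← Real.exp_nat_mul, ← Real.exp_add]
    congr 1
    ring
  rw [hexp] at hle
  exact absurd (le_of_mul_le_mul_right hle (by positivity)) (not_le.2 hT)

end Sampling

/-! ### Small teaching sets. -/

section Teaching

open Finset

variable {α : Type*} [DecidableEq α]

/-- `R` is a teaching set for `c` in `𝒜`: every member of `𝒜` that agrees with `c` on `R` is `c`. -/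
def Finset.IsTeachingSet (𝒜 : Finset (Finset α)) (c R : Finset α) : Prop :=
  ∀ c' ∈ 𝒜, R ∩ c' = R ∩ c → c' = c

/-- A bound on the least size of a teaching set in a family of VC dimension at most `d`. -/
def teachingBound : ℕ → ℕ
  | 0 => 0
  | d + 1 => teachingBound d + (2 ^ (d + 1) * d + 1)

theorem Finset.card_le_one_of_vcDim_eq_zero {𝒜 : Finset (Finset α)} (h : 𝒜.vcDim ≤ 0)
    {c c' : Finset α} (hc : c ∈ 𝒜) (hc' : c' ∈ 𝒜) : c' = c := by
  by_contra hne
  obtain ⟨a, ha⟩ : ∃ a, ¬ (a ∈ c' ↔ a ∈ c) := by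
    by_contra! hcon
    exact hne (Finset.ext hcon)
  have hs : 𝒜.Shatters {a} := by
    intro t ht
    by_cases hat : a ∈ t
    · have : t = {a} := subset_antisymm ht (by simpa using hat)
      by_cases hac : a ∈ c
      · exact ⟨c, hc, by simp [this, hac]⟩
      · exact ⟨c', hc', by simp [this, show a ∈ c' by tauto]⟩
    · have : t = ∅ := by
        rcases subset_singleton_iff.1 ht with h | h
        · exact h
        · simp [h] at hat
      by_cases hac : a ∈ c
      · exact ⟨c', hc', by simp [this, show a ∉ c' by tauto]⟩
      · exact ⟨c, hc, by simp [this, hac]⟩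
  simpa using vcDim_le_iff.1 h _ hs

/-- Chen, Cheng and Tang: a nonempty finite family of bounded VC dimension has a member with a
teaching set of bounded size. -/
theorem Finset.exists_isTeachingSet [Fintype α] (d : ℕ) :
    ∀ {𝒜 : Finset (Finset α)}, 𝒜.Nonempty → 𝒜.vcDim ≤ d →
      ∃ c ∈ 𝒜, ∃ R : Finset α, #R ≤ teachingBound d ∧ 𝒜.IsTeachingSet c R := by
  induction d with
  | zero =>
    rintro 𝒜 ⟨c, hc⟩ h
    exact ⟨c, hc, ∅, by simp, fun c' hc' _ => card_le_one_of_vcDim_eq_zero h hc hc'⟩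
  | succ d ih =>
    rintro 𝒜 ⟨c₀, hc₀⟩ h
    -- One more than `d` times the number of patterns on `d + 1` points, for the pigeonhole below. A
    -- ground set smaller than `m` is itself a teaching set.
    obtain ⟨m, hm⟩ : ∃ m, m = 2 ^ (d + 1) * d + 1 := ⟨_, rfl⟩
    have hbd : teachingBound (d + 1) = teachingBound d + m := by rw [hm]; rfl
    rcases lt_or_ge (Fintype.card α) m with hcard | hcard
    · refine ⟨c₀, hc₀, univ, ?_, fun c' _ h' => by simpa using h'⟩
      rw [card_univ]
      omega
    obtain ⟨Y₀, -, hY₀⟩ := exists_subset_card_eq (s := (univ : Finset α)) (n := m) (by rwa [card_univ])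
    let S : Set (Finset α × Finset α) := {q | #q.2 = m ∧ q.1 ∈ 𝒜}
    let res : Finset α × Finset α → Finset (Finset α) := fun q =>
      𝒜.filter fun c => ∀ y ∈ q.2, y ∈ c ↔ y ∈ q.1
    -- Extremal choice: the `m` points of `Y`, labelled by `b`, leave as few members as possible. If
    -- these have dimension at most `d`, induction applies; otherwise a better choice exists.
    obtain ⟨⟨b, Y⟩, ⟨hY, hb⟩, hmin⟩ :
        ∃ q ∈ S, ∀ q' ∈ S, #(res q) ≤ #(res q') := by
      have hSne : S.Nonempty := ⟨(c₀, Y₀), hY₀, hc₀⟩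
      refine ⟨_, WellFounded.min_mem (measure fun q => #(res q)).wf S hSne, fun q' hq' => ?_⟩
      exact not_lt.1 (WellFounded.not_lt_min (measure fun q => #(res q)).wf S hq')
    simp only at hY hb
    have hres : ∀ c, c ∈ res (b, Y) ↔ c ∈ 𝒜 ∧ ∀ y ∈ Y, y ∈ c ↔ y ∈ b := fun c => mem_filter
    by_cases hdim : (res (b, Y)).vcDim ≤ d
    · obtain ⟨c, hc, R, hR, hcR⟩ := ih ⟨b, (hres b).2 ⟨hb, fun _ _ => Iff.rfl⟩⟩ hdim
      refine ⟨c, ((hres c).1 hc).1, R ∪ Y, (card_union_le _ _).trans (by omega), ?_⟩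
      intro c' hc' hcc'
      have hmem : ∀ x ∈ R ∪ Y, x ∈ c' ↔ x ∈ c := fun x hx => by
        have := Finset.ext_iff.1 hcc' x
        simpa only [mem_inter, hx, true_and] using this
      refine hcR c' ((hres c').2 ⟨hc', fun y hy => ?_⟩) ?_
      · exact (hmem y (mem_union_right _ hy)).trans (((hres c).1 hc).2 y hy)
      · ext x
        simp only [mem_inter]
        exact and_congr_right fun hx => hmem x (mem_union_left _ hx)
    exfalso
    obtain ⟨Z, hZs, hZd⟩ : ∃ Z, (res (b, Y)).Shatters Z ∧ d < #Z := by
      rw [vcDim_le_iff] at hdim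
      push Not at hdim
      exact hdim
    have hZc : #Z = d + 1 :=
      le_antisymm (vcDim_le_iff.1 h Z (hZs.mono_left (filter_subset _ _))) hZd
    have hpat : ∀ t ⊆ Z, ∃ u ∈ 𝒜, (∀ y ∈ Y, y ∈ u ↔ y ∈ b) ∧ Z ∩ u = t := by
      intro t ht
      obtain ⟨u, hu, hut⟩ := hZs ht
      exact ⟨u, ((hres u).1 hu).1, ((hres u).1 hu).2, hut⟩
    have hYZ : ∀ y ∈ Y, y ∉ Z := by
      intro y hy hyZ
      obtain ⟨u, -, hu, hut⟩ := hpat ∅ (empty_subset _)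
      obtain ⟨u', -, hu', hut'⟩ := hpat Z subset_rfl
      have h1 : y ∈ u' := (mem_inter.1 (by rwa [hut'] : y ∈ Z ∩ u')).2
      have h2 : y ∈ Z ∩ u := mem_inter.2 ⟨hyZ, (hu y hy).2 ((hu' y hy).1 h1)⟩
      rw [hut] at h2
      exact absurd h2 (notMem_empty y)
    -- As `insert y Z` has `d + 2` points, some pattern on it is missing, so its restriction `t` to
    -- `Z` forces the label of `y`. Since `t` is also realized by a member agreeing with `b` on `Y`,
    -- the forced label is that of `b`.
    have hmiss : ∀ y ∈ Y, ∃ t ∈ Z.powerset, ∀ c ∈ 𝒜, Z ∩ c = t → (y ∈ c ↔ y ∈ b) := by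
      intro y hy
      have hns : ¬ 𝒜.Shatters (insert y Z) := fun hs => by
        have := vcDim_le_iff.1 h _ hs
        rw [card_insert_of_notMem (hYZ y hy)] at this
        omega
      unfold Shatters at hns
      push Not at hns
      obtain ⟨t, ht, hmis⟩ := hns
      refine ⟨Z ∩ t, mem_powerset.2 inter_subset_left, ?_⟩
      have hagree : ∀ c ∈ 𝒜, Z ∩ c = Z ∩ t → ¬ (y ∈ c ↔ y ∈ t) := by
        intro c hc hct hy'
        refine hmis c hc ?_
        ext x
        rw [mem_inter, mem_insert]
        have hx := Finset.ext_iff.1 hct x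
        rw [mem_inter, mem_inter] at hx
        have hxt := @ht x
        rw [mem_insert] at hxt
        constructor
        · rintro ⟨rfl | h1, h2⟩
          · exact hy'.1 h2
          · exact (hx.1 ⟨h1, h2⟩).2
        · intro h1
          rcases hxt h1 with rfl | h2
          · exact ⟨Or.inl rfl, hy'.2 h1⟩
          · exact ⟨Or.inr h2, (hx.2 ⟨h2, h1⟩).2⟩
      intro c hc hct
      obtain ⟨u, hu, hub, hut⟩ := hpat (Z ∩ t) inter_subset_left
      have h1 := hagree c hc hct
      have h2 := hagree u hu hut
      have h3 := hub y hy
      tauto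
    choose! g hgZ hg using hmiss
    -- By pigeonhole `d + 1` points of `Y` are forced by one pattern `t`. Exchanging them for the `d
    -- + 1` points of `Z` labelled by `t` keeps the size `m` and all old constraints, and excludes
    -- the members with another pattern on `Z`.
    obtain ⟨t, ht, hfib⟩ := exists_lt_card_fiber_of_mul_lt_card_of_maps_to (n := d) hgZ
      (by rw [card_powerset, hZc, hY]; omega)
    obtain ⟨Y₁, hY₁, hY₁c⟩ := exists_subset_card_eq (Nat.succ_le_of_lt hfib)
    have hY₁Y : Y₁ ⊆ Y := hY₁.trans (filter_subset _ _)
    obtain ⟨u, hu, hub, hut⟩ := hpat t (mem_powerset.1 ht)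
    have hcardY' : #((Y \ Y₁) ∪ Z) = m := by
      rw [card_union_of_disjoint, card_sdiff_of_subset hY₁Y]
      · have := card_le_card hY₁Y
        omega
      · exact disjoint_left.2 fun y hy => hYZ y (mem_sdiff.1 hy).1
    have hZagree : ∀ c, (∀ y ∈ (Y \ Y₁) ∪ Z, y ∈ c ↔ y ∈ u) → Z ∩ c = t := by
      intro c hc
      rw [← hut]
      ext x
      simp only [mem_inter]
      exact and_congr_right fun hx => hc x (mem_union_right _ hx)
    refine absurd (hmin (u, (Y \ Y₁) ∪ Z) ⟨hcardY', hu⟩) (not_le.2 (card_lt_card ?_))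
    refine (Finset.ssubset_iff_of_subset ?_).2 ?_
    · intro c hc
      obtain ⟨hc, hcu⟩ := mem_filter.1 hc
      refine (hres c).2 ⟨hc, fun y hy => ?_⟩
      by_cases hy1 : y ∈ Y₁
      · refine hg y hy c hc ?_
        rw [(mem_filter.1 (hY₁ hy1)).2]
        exact hZagree c hcu
      · exact (hcu y (mem_union_left _ (mem_sdiff.2 ⟨hy, hy1⟩))).trans (hub y hy)
    · obtain ⟨t', ht', hne⟩ : ∃ t' ⊆ Z, t' ≠ t := by
        by_cases h0 : t = ∅
        · refine ⟨Z, subset_rfl, fun hZ => ?_⟩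
          rw [hZ, h0] at hZc
          simp at hZc
        · exact ⟨∅, empty_subset _, fun h' => h0 h'.symm⟩
      obtain ⟨u', hu', hub', hut'⟩ := hpat t' ht'
      refine ⟨u', (hres u').2 ⟨hu', hub'⟩, fun hmem => hne ?_⟩
      rw [← hut', hZagree u' (mem_filter.1 hmem).2]

end Teaching

/-! ### Minimax, and majority votes of teachable members. -/

section Compression

open Finset

variable {α : Type*} [DecidableEq α]

/-- Von Neumann minimax: if every weight on `X` has a good response in `Y`,
then some weight on `Y` is a good response to every element of `X`. -/
theorem exists_weight_of_forall_weight {X Y : Type*} [Fintype X] [Fintype Y] [Nonempty X]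
    (E : X → Y → ℝ) (r : ℝ)
    (h : ∀ μ : X → ℝ, (∀ x, 0 ≤ μ x) → ∑ x, μ x = 1 → ∃ y, r ≤ ∑ x, μ x * E x y) :
    ∃ ν : Y → ℝ, (∀ y, 0 ≤ ν y) ∧ ∑ y, ν y = 1 ∧ ∀ x, r ≤ ∑ y, ν y * E x y := by
  classical
  let f : (X → ℝ) → (Y → ℝ) → ℝ := fun μ ν => ∑ x, ∑ y, μ x * ν y * E x y
  have hYne : Nonempty Y := by
    obtain ⟨x⟩ := ‹Nonempty X›
    obtain ⟨y, -⟩ := h (Pi.single x 1) (fun x' => by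
      by_cases hx : x' = x
      · subst hx; simp
      · simp [hx]) (by simp)
    exact ⟨y⟩
  have hl : ∀ ν, IsLinearMap ℝ (fun μ => f μ ν) := fun ν =>
    ⟨fun a b => by simp [f, add_mul, sum_add_distrib],
      fun c a => by simp [f, mul_sum, mul_assoc]⟩
  have hr : ∀ μ, IsLinearMap ℝ (fun ν => f μ ν) := fun μ =>
    ⟨fun a b => by simp [f, add_mul, mul_add, sum_add_distrib],
      fun c a => by simp [f, mul_sum, mul_assoc, mul_left_comm]⟩
  obtain ⟨μ, hμ, ν, hν, hs⟩ := Sion.exists_isSaddlePointOn (X := stdSimplex ℝ X)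
    (Y := stdSimplex ℝ Y) (f := f)
    (by obtain ⟨x⟩ := ‹Nonempty X›; exact ⟨_, single_mem_stdSimplex ℝ x⟩)
    (convex_stdSimplex ℝ X) (isCompact_stdSimplex ℝ X)
    (fun ν _ => Continuous.lowerSemicontinuous (by fun_prop) |>.lowerSemicontinuousOn _)
    (fun ν _ => ((hl ν).mk' _).convexOn (convex_stdSimplex ℝ X) |>.quasiconvexOn)
    (convex_stdSimplex ℝ Y)
    (by obtain ⟨y⟩ := hYne; exact ⟨_, single_mem_stdSimplex ℝ y⟩)
    (isCompact_stdSimplex ℝ Y)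
    (fun ν _ => Continuous.upperSemicontinuous (by fun_prop) |>.upperSemicontinuousOn _)
    (fun μ _ => ((hr μ).mk' _).concaveOn (convex_stdSimplex ℝ Y) |>.quasiconcaveOn)
  refine ⟨ν, hν.1, hν.2, fun x => ?_⟩
  obtain ⟨y, hy⟩ := h μ hμ.1 hμ.2
  -- The saddle point is tested against pure strategies on both sides.
  have h1 := hs _ (single_mem_stdSimplex ℝ x) _ (single_mem_stdSimplex ℝ y)
  have e1 : f μ (Pi.single y 1) = ∑ x, μ x * E x y := by
    simp [f, Pi.single_apply]
  have e2 : f (Pi.single x 1) ν = ∑ y, ν y * E x y := by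
    simp [f, Pi.single_apply]
  rw [e1, e2] at h1
  exact hy.trans h1

/-- Symmetric difference with `c` only permutes the patterns on each set. -/
theorem Finset.vcDim_image_symmDiff_le (𝒜 : Finset (Finset α)) (c : Finset α) :
    (𝒜.image fun c' => symmDiff c' c).vcDim ≤ 𝒜.vcDim := by
  rw [vcDim_le_iff]
  intro s hs
  refine Shatters.card_le_vcDim fun t ht => ?_
  obtain ⟨u, hu, hut⟩ := hs (t := s ∩ symmDiff t c) inter_subset_left
  obtain ⟨c', hc', rfl⟩ := mem_image.1 hu
  refine ⟨c', hc', ?_⟩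
  ext x
  have h1 := Finset.ext_iff.1 hut x
  have h2 := @ht x
  simp only [mem_inter, mem_symmDiff] at h1 ⊢
  tauto

/-- A concept with a small teaching set that approximates `c` with respect to a weight. -/
theorem exists_teachable_approximation (d : ℕ) : ∃ s : ℕ,
    ∀ {α : Type w} [DecidableEq α] [Fintype α] (𝒜 : Finset (Finset α)), 𝒜.vcDim ≤ d →
      ∀ c ∈ 𝒜, ∀ μ : α → ℝ, (∀ x, 0 ≤ μ x) → ∑ x, μ x = 1 →
        ∃ c' ∈ 𝒜, (∃ R : Finset α, #R ≤ s ∧ 𝒜.IsTeachingSet c' R) ∧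
          ∑ x ∈ symmDiff c' c, μ x ≤ 1 / 3 := by
  obtain ⟨T, hT0, hT⟩ := exists_uniform_sample.{w} d (δ := 1 / 3) (by norm_num)
  refine ⟨T + teachingBound d, ?_⟩
  intro α _ _ 𝒜 h𝒜 c hc μ hμ hμ1
  -- Each difference from `c` of weight above 1/3 is hit by the sample. So every member agreeing
  -- with `c` on the sample is close to `c`, and a teachable one may be chosen among them.
  obtain ⟨S, hS⟩ := hT _ μ ((vcDim_image_symmDiff_le 𝒜 c).trans h𝒜) hμ hμ1
  let Q : Finset α := univ.image S
  let ℬ := 𝒜.filter fun c' => Q ∩ c' = Q ∩ c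
  obtain ⟨c', hc', R, hR, hcR⟩ := exists_isTeachingSet d (𝒜 := ℬ)
    ⟨c, mem_filter.2 ⟨hc, rfl⟩⟩ ((vcDim_mono (filter_subset _ _)).trans h𝒜)
  obtain ⟨hc'A, hc'Q⟩ := mem_filter.1 hc'
  refine ⟨c', hc'A, ⟨Q ∪ R, ?_, ?_⟩, ?_⟩
  · refine (card_union_le _ _).trans (Nat.add_le_add ?_ hR)
    exact card_image_le.trans (by simp)
  · intro e he hee
    have hsub : ∀ Z ⊆ Q ∪ R, Z ∩ e = Z ∩ c' := fun Z hZ => by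
      rw [← inter_eq_left.2 hZ, inter_assoc, hee, ← inter_assoc]
    exact hcR e (mem_filter.2 ⟨he, (hsub Q subset_union_left).trans hc'Q⟩)
      (hsub R subset_union_right)
  · have h1 := hS _ (mem_image_of_mem _ hc'A)
    have h2 : (univ.filter fun t => S t ∈ symmDiff c' c) = ∅ := by
      refine filter_eq_empty_iff.2 fun t _ ht => ?_
      have := Finset.ext_iff.1 hc'Q (S t)
      simp only [mem_inter, Q, mem_image, mem_univ, true_and, exists_apply_eq_apply] at this
      rw [mem_symmDiff] at ht
      tauto
    rw [h2] at h1
    have hTpos : (0 : ℝ) < T := by exact_mod_cast hT0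
    have : (∑ x ∈ symmDiff c' c, μ x) - 1 / 3 ≤ 0 := by
      by_contra! hcon
      have := mul_pos hTpos hcon
      simp only [card_empty, Nat.cast_zero] at h1
      linarith
    linarith

/-- The dual of a set family of VC dimension at most `d`, twisted by a set `c`, has VC dimension
at most `2 ^ (d + 1)`. -/
theorem Finset.vcDim_image_agreement_le [Fintype α] {𝒜 : Finset (Finset α)} {d : ℕ}
    (h𝒜 : 𝒜.vcDim ≤ d) (c : Finset α) {H : Finset (Finset α)} (hH : H ⊆ 𝒜) :
    ((univ : Finset α).image fun x => (univ : Finset H).filter fun e =>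
      x ∈ e.1 ↔ x ∈ c).vcDim ≤ 2 ^ (d + 1) := by
  rw [vcDim_le_iff]
  intro s hs
  by_contra! hlt
  -- Indexing members by Boolean vectors, take `x i` to agree with `c` exactly on the members whose
  -- `i`-th bit is true. These `d + 1` points are then shattered by `𝒜`; the twist by `c` is undone
  -- in the choice of the vector.
  obtain ⟨e⟩ : Nonempty ((Fin (d + 1) → Bool) ↪ s) := by
    refine Function.Embedding.nonempty_of_card_le ?_
    simpa using hlt.le
  have hx : ∀ i : Fin (d + 1), ∃ x : α, ∀ a : Fin (d + 1) → Bool,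
      (x ∈ (e a).1.1 ↔ x ∈ c) ↔ a i = true := by
    intro i
    obtain ⟨u, hu, hut⟩ := hs (t := (univ.filter fun a : Fin (d + 1) → Bool => a i = true).image
      fun a => (e a).1) (by
        intro y hy
        obtain ⟨a, -, rfl⟩ := mem_image.1 hy
        exact (e a).2)
    obtain ⟨x, -, rfl⟩ := mem_image.1 hu
    refine ⟨x, fun a => ?_⟩
    have := Finset.ext_iff.1 hut (e a).1
    simp only [mem_inter, (e a).2, true_and, mem_filter, mem_univ, mem_image] at this
    rw [this]
    constructor
    · rintro ⟨a', ha', h'⟩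
      rwa [e.injective (Subtype.ext h')] at ha'
    · exact fun h' => ⟨a, h', rfl⟩
  choose x hx using hx
  have hreal : ∀ p : Fin (d + 1) → Prop, ∃ b ∈ 𝒜, ∀ i, x i ∈ b ↔ p i := by
    intro p
    classical
    refine ⟨(e fun i => decide (p i ↔ x i ∈ c)).1.1, hH (e _).1.2, fun i => ?_⟩
    have := hx i fun i => decide (p i ↔ x i ∈ c)
    rw [decide_eq_true_eq] at this
    tauto
  have hinj : Function.Injective x := by
    intro i j hij
    obtain ⟨b, -, hb⟩ := hreal fun k => k = i
    exact ((hb j).1 (hij ▸ (hb i).2 rfl)).symm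
  have hsh : 𝒜.Shatters (univ.image x) := by
    intro t ht
    obtain ⟨b, hb, hbt⟩ := hreal fun i => x i ∈ t
    refine ⟨b, hb, ?_⟩
    ext y
    constructor
    · intro hy
      obtain ⟨hy1, hy2⟩ := mem_inter.1 hy
      obtain ⟨i, -, rfl⟩ := mem_image.1 hy1
      exact (hbt i).1 hy2
    · intro hy
      obtain ⟨i, -, rfl⟩ := mem_image.1 (ht hy)
      exact mem_inter.2 ⟨ht hy, (hbt i).2 hy⟩
  have := vcDim_le_iff.1 h𝒜 _ hsh
  rw [card_image_of_injective _ hinj, card_univ, Fintype.card_fin] at this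
  omega

/-- Every member of a set family of bounded VC dimension is the pointwise majority of boundedly
many members having teaching sets of bounded size. -/
theorem exists_majority_of_teachable (d : ℕ) : ∃ s T : ℕ,
    ∀ {α : Type w} [DecidableEq α] [Fintype α] [Nonempty α] (𝒜 : Finset (Finset α)),
      𝒜.vcDim ≤ d → ∀ c ∈ 𝒜, ∃ e : Fin T → Finset α,
        (∀ t, e t ∈ 𝒜 ∧ ∃ R : Finset α, #R ≤ s ∧ 𝒜.IsTeachingSet (e t) R) ∧
        ∀ x, T < 2 * #(univ.filter fun t => x ∈ e t ↔ x ∈ c) := by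
  obtain ⟨s, hs⟩ := exists_teachable_approximation.{w} d
  obtain ⟨T, hT0, hT⟩ := exists_uniform_sample.{w} (2 ^ (d + 1)) (δ := 1 / 12) (by norm_num)
  refine ⟨s, T, ?_⟩
  intro α _ _ _ 𝒜 h𝒜 c hc
  classical
  let H : Finset (Finset α) :=
    𝒜.filter fun e => ∃ R : Finset α, #R ≤ s ∧ 𝒜.IsTeachingSet e R
  obtain ⟨ν, hν, hν1, hνx⟩ := exists_weight_of_forall_weight (X := α) (Y := H)
    (fun x e => if (x ∈ e.1 ↔ x ∈ c) then 1 else 0) (2 / 3) (by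
      intro μ hμ hμ1
      obtain ⟨e, he, hR, hle⟩ := hs 𝒜 h𝒜 c hc μ hμ hμ1
      refine ⟨⟨e, mem_filter.2 ⟨he, hR⟩⟩, ?_⟩
      have h1 : ∑ x, μ x = ∑ x ∈ symmDiff e c, μ x + ∑ x, μ x * (if (x ∈ e ↔ x ∈ c) then 1 else 0)
          := by
        rw [← sum_filter_add_sum_filter_not univ (fun x => x ∈ symmDiff e c)]
        congr 1
        · simp
        · simp_rw [mul_ite, mul_one, mul_zero]
          rw [← sum_filter]
          refine sum_congr ?_ fun _ _ => rfl
          ext x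
          simp only [mem_filter, mem_univ, true_and, mem_symmDiff]
          tauto
      simp only
      linarith)
  obtain ⟨S, hS⟩ := hT _ ν (vcDim_image_agreement_le h𝒜 c (filter_subset _ _)) hν hν1
  refine ⟨fun t => (S t).1, fun t => mem_filter.1 (S t).2, fun x => ?_⟩
  have h1 := hS _ (mem_image_of_mem _ (mem_univ x))
  have h2 := hνx x
  simp_rw [mul_ite, mul_one, mul_zero] at h2
  rw [← sum_filter] at h2
  simp only [mem_filter, mem_univ, true_and] at h1
  have hTpos : (0 : ℝ) < T := by exact_mod_cast hT0
  -- The sampled proportion is at least 2/3 − 1/12 = 7/12, a strict majority.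
  have h3 : (T : ℝ) < 2 * #(univ.filter fun t => x ∈ (S t).1 ↔ x ∈ c) := by
    nlinarith
  exact_mod_cast h3

end Compression

namespace POIndisc

/-! ### Traces of `φ` on finite parameter families. -/

section Traces

variable {L : FirstOrder.Language.{u, v}} {M : Type w} [L.Structure M] {k m : ℕ}

open Classical in
/-- The traces on a finite family of parameters of the sets defined by instances of `φ`. -/
noncomputable def traceFamily (φ : L.Formula (Fin k ⊕ Fin m)) {P : Type w'} [Fintype P]
    (b : P → Fin m → M) : Finset (Finset P) :=
  Finset.univ.filter fun A => ∃ a : Fin k → M, ∀ i, i ∈ A ↔ φ.Realize (Sum.elim a (b i))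

theorem mem_traceFamily {φ : L.Formula (Fin k ⊕ Fin m)} {P : Type w'} [Fintype P]
    {b : P → Fin m → M} {A : Finset P} :
    A ∈ traceFamily φ b ↔ ∃ a : Fin k → M, ∀ i, i ∈ A ↔ φ.Realize (Sum.elim a (b i)) := by
  simp [traceFamily]

theorem injOn_and_isIndependent_of_shatters {P : Type w'} [Fintype P]
    [DecidableEq P] {φ : L.Formula (Fin k ⊕ Fin m)} {b : P → Fin m → M} {A : Finset P}
    (hA : (traceFamily φ b).Shatters A) :
    Set.InjOn b A ∧ IsIndependent φ (b '' A) := by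
  have key : ∀ p : P → Prop, ∃ a : Fin k → M, ∀ i ∈ A, p i ↔ φ.Realize (Sum.elim a (b i)) := by
    intro p
    classical
    obtain ⟨u, hu, hut⟩ := hA (Finset.filter_subset p A)
    obtain ⟨a, ha⟩ := mem_traceFamily.1 hu
    refine ⟨a, fun i hi => ?_⟩
    have := Finset.ext_iff.1 hut i
    simp only [Finset.mem_inter, hi, true_and, Finset.mem_filter] at this
    rw [← this, ha]
  constructor
  · intro i hi j hj hij
    obtain ⟨a, ha⟩ := key fun l => l = i
    have h1 := (ha i hi).1 rfl
    rw [hij] at h1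
    exact ((ha j hj).2 h1).symm
  · intro s
    obtain ⟨a, ha⟩ := key fun i => ∃ h : b i ∈ b '' A, s ⟨b i, h⟩ = true
    refine ⟨M, inferInstance, FirstOrder.Language.ElementaryEmbedding.refl L M, a, ?_⟩
    rintro _ ⟨⟨_, i, hi, rfl⟩, rfl⟩
    exact (ha i hi).symm.trans ⟨fun ⟨_, h⟩ => h, fun h => ⟨_, h⟩⟩

theorem vcDim_traceFamily_le {T : L.Theory} {φ : L.Formula (Fin k ⊕ Fin m)} {N : ℕ}
    (hN : HasIndependenceDimension.{u, v, w} T φ N)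
    (M : FirstOrder.Language.Theory.ModelType.{u, v, max u v w} T) {P : Type w'} [Fintype P]
    [DecidableEq P] (b : P → Fin m → M) : (traceFamily φ b).vcDim ≤ N := by
  rw [Finset.vcDim_le_iff]
  intro A hA
  obtain ⟨h1, h2⟩ := injOn_and_isIndependent_of_shatters hA
  refine hN.2 ⟨M, b '' A, ?_, h2⟩
  rw [h1.encard_image, Set.encard_coe_eq_coe_finsetCard]

end Traces

/-! ### Formulas for decoding, majority and patterns. -/

section Formulas

variable {L : FirstOrder.Language.{u, v}} {M : Type w} [L.Structure M] {k m : ℕ}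

open FirstOrder.Language

/-- The formula expressing that the `m`-tuples of variables `z_i` and `z_j` are equal. -/
noncomputable def tupleEq {β : Type} (L : FirstOrder.Language.{u, v}) (m : ℕ)
    (z z' : Fin m → β) : L.Formula β :=
  Formula.iInf fun l => Term.equal (Term.var (z l)) (Term.var (z' l))

theorem realize_tupleEq {β : Type} {z z' : Fin m → β} {x : β → M} :
    (tupleEq L m z z').Realize x ↔ x ∘ z = x ∘ z' := by
  simp [tupleEq, Formula.realize_iInf, Formula.realize_equal, funext_iff]

/-- The formula expressing that some `x̄` satisfies `φ(x̄; ȳ)` and, for all `j`, satisfies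
`φ(x̄; z̄_{j0})` exactly when `z̄_{j1} = z̄_{j2}`. -/
noncomputable def decodeFormula (φ : L.Formula (Fin k ⊕ Fin m)) {J ι : Type} [Finite J]
    (z : J → Fin 3 → ι) : L.Formula (Fin m ⊕ ι × Fin m) :=
  Formula.iExs (α := Fin m ⊕ ι × Fin m) (Fin k)
    (φ.relabel (Sum.elim Sum.inr fun l => Sum.inl (Sum.inl l)) ⊓
      Formula.iInf fun j : J =>
        (φ.relabel (Sum.elim Sum.inr fun l => Sum.inl (Sum.inr (z j 0, l)))).iff
          (tupleEq L m (fun l => Sum.inl (Sum.inr (z j 1, l)))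
            fun l => Sum.inl (Sum.inr (z j 2, l))))

theorem realize_decodeFormula {φ : L.Formula (Fin k ⊕ Fin m)} {J ι : Type} [Finite J]
    {z : J → Fin 3 → ι} {y : Fin m → M} {c : ι → Fin m → M} :
    (decodeFormula φ z).Realize (Sum.elim y fun q => c q.1 q.2) ↔
      ∃ a : Fin k → M, φ.Realize (Sum.elim a y) ∧
        ∀ j, φ.Realize (Sum.elim a (c (z j 0))) ↔ c (z j 1) = c (z j 2) := by
  rw [decodeFormula, Formula.realize_iExs]
  refine exists_congr fun a => ?_
  rw [Formula.realize_inf, Formula.realize_relabel, Formula.realize_iInf]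
  refine and_congr (iff_of_eq ?_) (forall_congr' fun j => ?_)
  · congr 1
    funext l
    rcases l with l | l <;> rfl
  · rw [Formula.realize_iff, Formula.realize_relabel, realize_tupleEq]
    refine iff_congr (iff_of_eq ?_) Iff.rfl
    congr 1
    funext l
    rcases l with l | l <;> rfl

/-- The formula expressing that more than half of the formulas `θ t` hold. -/
noncomputable def majorityFormula {β : Type} {T : ℕ} (θ : Fin T → L.Formula β) : L.Formula β :=
  Formula.iSup fun A : {A : Finset (Fin T) // T < 2 * A.card} =>
    Formula.iInf fun t : A.1 => θ t

theorem realize_majorityFormula {β : Type} {T : ℕ} {θ : Fin T → L.Formula β} {x : β → M}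
    {p : Prop}
    (h : ∃ A : Finset (Fin T), T < 2 * A.card ∧ ∀ t ∈ A, (θ t).Realize x ↔ p) :
    (majorityFormula θ).Realize x ↔ p := by
  obtain ⟨A, hA, hAp⟩ := h
  simp only [majorityFormula, Formula.realize_iSup, Formula.realize_iInf]
  constructor
  · rintro ⟨⟨B, hB⟩, hBx⟩
    -- Two strict majorities of the same index set meet.
    obtain ⟨t, ht⟩ : (A ∩ B).Nonempty := by
      rw [← Finset.card_pos]
      have h1 := Finset.card_union_add_card_inter A B
      have h2 := Finset.card_le_univ (A ∪ B)
      rw [Fintype.card_fin] at h2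
      omega
    obtain ⟨htA, htB⟩ := Finset.mem_inter.1 ht
    exact (hAp t htA).1 (hBx ⟨t, htB⟩)
  · exact fun hp => ⟨⟨A, hA⟩, fun t => (hAp t t.2).2 hp⟩

open Classical in
/-- The formula expressing that some `x̄` satisfies `φ(x̄; z̄_i)` exactly for those `i` for which
`s i` holds. -/
noncomputable def patternFormula (φ : L.Formula (Fin k ⊕ Fin m)) {P : Type} [Finite P]
    (s : P → Prop) : L.Formula (P × Fin m) :=
  Formula.iExs (α := P × Fin m) (Fin k)
    (Formula.iInf fun i : P =>
      let ψ : L.Formula ((P × Fin m) ⊕ Fin k) :=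
        φ.relabel (Sum.elim Sum.inr fun l => Sum.inl (i, l))
      if s i then ψ else ψ.not)

theorem realize_patternFormula {φ : L.Formula (Fin k ⊕ Fin m)} {P : Type} [Finite P]
    {s : P → Prop} {c : P → Fin m → M} :
    (patternFormula φ s).Realize (fun q => c q.1 q.2) ↔
      ∃ a : Fin k → M, ∀ i, s i ↔ φ.Realize (Sum.elim a (c i)) := by
  rw [patternFormula, Formula.realize_iExs]
  refine exists_congr fun a => ?_
  rw [Formula.realize_iInf]
  refine forall_congr' fun i => ?_
  have : (Sum.elim (fun q : P × Fin m => c q.1 q.2) a ∘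
      Sum.elim Sum.inr fun l => Sum.inl (i, l) : Fin k ⊕ Fin m → M) = Sum.elim a (c i) := by
    funext l
    rcases l with l | l <;> rfl
  by_cases h : s i
  · simp only [h, if_true, Formula.realize_relabel, this, true_iff]
  · simp only [h, if_false, Formula.realize_not, Formula.realize_relabel, this, false_iff]

/-- A pattern on finitely many parameters is a single formula about them, so elementarity brings a
realization down to `M`. -/
theorem exists_forall_realize_iff_of_elementary {N : Type w'} [L.Structure N] (e : M ↪ₑ[L] N)
    {φ : L.Formula (Fin k ⊕ Fin m)} {P : Type} [Finite P] (b : P → Fin m → M) (a' : Fin k → N) :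
    ∃ a : Fin k → M, ∀ i, φ.Realize (Sum.elim a' (e ∘ b i)) ↔ φ.Realize (Sum.elim a (b i)) := by
  refine realize_patternFormula.1 ((e.map_formula (patternFormula φ fun i =>
    φ.Realize (Sum.elim a' (e ∘ b i))) fun q => b q.1 q.2).1 ?_)
  exact realize_patternFormula (c := fun i => e ∘ b i).2 ⟨a', fun _ => Iff.rfl⟩

theorem exists_forall_realize_iff_of_mem_typeSpace {φ : L.Formula (Fin k ⊕ Fin m)} {P : Type}
    [Finite P] {b : P → Fin m → M} {p : Set ((Fin m → M) × Bool)}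
    (hp : p ∈ typeSpace φ (Set.range b)) :
    ∃ a : Fin k → M, ∀ i, (b i, true) ∈ p ↔ φ.Realize (Sum.elim a (b i)) := by
  obtain ⟨hdom, N, _, e, a', ha'⟩ := hp
  obtain ⟨a, ha⟩ := exists_forall_realize_iff_of_elementary e (φ := φ) b a'
  refine ⟨a, fun i => Iff.trans ⟨fun h => (ha' _ h).2 rfl, fun h => ?_⟩ (ha i)⟩
  obtain ⟨t, ht⟩ := (hdom (b i)).2 ⟨i, rfl⟩
  have ht1 : t = true := (ha' _ ht).1 h
  rwa [ht1] at ht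

end Formulas

/-! ### Uniform definability of types over finite sets. -/

section UniformDefinability

variable {L : FirstOrder.Language.{u, v}} {k m : ℕ}

theorem exists_fin_forall_mem_range {P : Type} [Nonempty P] {s : ℕ} {R : Finset P}
    (h : R.card ≤ s) : ∃ r : Fin s → P, ∀ x ∈ R, ∃ j, r j = x := by
  classical
  obtain ⟨x₀⟩ := ‹Nonempty P›
  refine ⟨fun j => if hj : j.1 < R.card then (R.equivFin.symm ⟨j, hj⟩).1 else x₀, fun x hx => ?_⟩
  have hlt := (R.equivFin ⟨x, hx⟩).2
  exact ⟨⟨R.equivFin ⟨x, hx⟩, hlt.trans_le h⟩, by simp⟩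

/-- Uniform definability of types over finite sets for dependent formulas. -/
theorem exists_uniform_definition_of_isDependent {T : L.Theory} {φ : L.Formula (Fin k ⊕ Fin m)}
    (h : IsDependent.{u, v, w} T φ) :
    ∃ (n : ℕ) (ψ : L.Formula (Fin m ⊕ Fin n × Fin m)),
      ∀ (P : Type) [Finite P]
        (M : FirstOrder.Language.Theory.ModelType.{u, v, max u v w} T) (b : P → Fin m → M),
        (Set.range b).Nontrivial →
        ∀ p ∈ typeSpace φ (Set.range b), ∃ i : Fin n → P, ∀ j : P,
          (b j, true) ∈ p ↔ ψ.Realize (Sum.elim (b j) fun q => b (i q.1) q.2) := by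
  obtain ⟨N, hN⟩ := h
  obtain ⟨s, K, hsK⟩ := exists_majority_of_teachable.{0} N
  let ε : Fin K × Fin s × Fin 3 ≃ Fin (Fintype.card (Fin K × Fin s × Fin 3)) :=
    Fintype.equivFin _
  refine ⟨_, majorityFormula fun t : Fin K =>
    decodeFormula φ fun (j : Fin s) (r : Fin 3) => ε (t, j, r), ?_⟩
  intro P _ M b hb p hp
  classical
  have := Fintype.ofFinite P
  obtain ⟨_, ⟨i₀, rfl⟩, _, ⟨i₁, rfl⟩, hne⟩ := hb
  have : Nonempty P := ⟨i₀⟩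
  obtain ⟨a, ha⟩ := exists_forall_realize_iff_of_mem_typeSpace hp
  let c : Finset P := Finset.univ.filter fun i => (b i, true) ∈ p
  have hc : c ∈ traceFamily φ b := mem_traceFamily.2 ⟨a, fun i => by simp [c, ha]⟩
  obtain ⟨e, he, hmaj⟩ := hsK (traceFamily φ b) (vcDim_traceFamily_le hN M b) c hc
  choose heA R hRs hR using he
  choose r hr using fun t => exists_fin_forall_mem_range (hRs t)
  -- Each teaching point takes three parameters: the point, then a pair that is equal exactly when
  -- its label is positive.
  let z : Fin K × Fin s × Fin 3 → P := fun q =>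
    if q.2.2 = 0 then r q.1 q.2.1 else if q.2.2 = 1 then i₀ else
      if r q.1 q.2.1 ∈ e q.1 then i₀ else i₁
  refine ⟨z ∘ ε.symm, fun j => ?_⟩
  refine (realize_majorityFormula ⟨_, hmaj j, fun t ht => ?_⟩).symm
  rw [Finset.mem_filter] at ht
  have hjc : j ∈ c ↔ (b j, true) ∈ p := by simp [c]
  rw [← hjc, ← ht.2]
  refine (realize_decodeFormula (c := fun q => b ((z ∘ ε.symm) q))).trans ?_
  have hlabel : ∀ l : Fin s, (b ((z ∘ ε.symm) (ε (t, l, 1))) = b ((z ∘ ε.symm) (ε (t, l, 2)))) ↔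
      r t l ∈ e t := by
    intro l
    by_cases hl : r t l ∈ e t <;> simp [z, hl, hne]
  have hpoint : ∀ l : Fin s, (z ∘ ε.symm) (ε (t, l, 0)) = r t l := fun l => by simp [z]
  simp only [hlabel, hpoint]
  constructor
  · rintro ⟨a', hj, ha'⟩
    let c' : Finset P := Finset.univ.filter fun i => φ.Realize (Sum.elim a' (b i))
    have hc' : c' ∈ traceFamily φ b := mem_traceFamily.2 ⟨a', fun i => by simp [c']⟩
    -- Any witness `a'` has the prescribed labels on the teaching set, so its trace is `e t`.
    have hce : c' = e t := by
      refine hR t c' hc' ?_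
      ext x
      simp only [Finset.mem_inter]
      refine and_congr_right fun hx => ?_
      obtain ⟨l, rfl⟩ := hr t x hx
      simp only [c', Finset.mem_filter, Finset.mem_univ, true_and]
      exact ha' l
    rw [← hce]
    simpa [c'] using hj
  · intro hj
    obtain ⟨a', ha'⟩ := mem_traceFamily.1 (heA t)
    exact ⟨a', (ha' j).1 hj, fun l => (ha' _).symm⟩

end UniformDefinability

end POIndisc

/-! ### Iterated products of a nonprincipal ultrafilter. -/

section IteratedUltrafilter

open Filter

/-- The iterated product of a nonprincipal ultrafilter on `ℕ`. -/
noncomputable def iteratedUltrafilter : (n : ℕ) → Ultrafilter (Fin n → ℕ)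
  | 0 => pure default
  | n + 1 => (hyperfilter ℕ).bind fun i => (iteratedUltrafilter n).map (Fin.cons i)

theorem eventually_iteratedUltrafilter_succ {n : ℕ} {Q : (Fin (n + 1) → ℕ) → Prop} :
    (∀ᶠ x in (iteratedUltrafilter (n + 1) : Filter _), Q x) ↔
      ∀ᶠ i in (hyperfilter ℕ : Filter ℕ), ∀ᶠ x in (iteratedUltrafilter n : Filter _),
        Q (Fin.cons i x) :=
  Iff.rfl

/-- Deleting coordinates from the iterated product yields the shorter iterated product: a quantifier
over a coordinate that does not occur is vacuous. This is the source of indiscernibility. -/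
theorem eventually_iteratedUltrafilter_comp {K : ℕ} : ∀ {n : ℕ} {f : Fin n → Fin K},
    StrictMono f → ∀ {Q : (Fin n → ℕ) → Prop},
      (∀ᶠ x in (iteratedUltrafilter K : Filter _), Q (x ∘ f)) ↔
        ∀ᶠ x in (iteratedUltrafilter n : Filter _), Q x := by
  induction K with
  | zero =>
    intro n f hf Q
    have hn : n = 0 := by
      by_contra hn
      exact (f ⟨0, Nat.pos_of_ne_zero hn⟩).elim0
    subst hn
    simp only [Subsingleton.elim _ (default : Fin 0 → ℕ)]
  | succ K ih =>
    intro n f hf Q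
    rw [eventually_iteratedUltrafilter_succ]
    by_cases h0 : ∀ a, f a ≠ 0
    · have hg : StrictMono fun a => (f a).pred (h0 a) := fun a b hab => by
        simpa using hf hab
      have hfac : ∀ (i : ℕ) (x : Fin K → ℕ),
          (Fin.cons i x : Fin (K + 1) → ℕ) ∘ f = x ∘ fun a => (f a).pred (h0 a) := by
        intro i x
        funext a
        conv_lhs => rw [Function.comp_apply, ← Fin.succ_pred (f a) (h0 a), Fin.cons_succ]
        rfl
      simp only [hfac, ih hg, eventually_const]
    · push Not at h0
      obtain ⟨a₀, ha₀⟩ := h0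
      obtain ⟨n, rfl⟩ : ∃ n', n = n' + 1 := Nat.exists_eq_succ_of_ne_zero (by
        rintro rfl
        exact a₀.elim0)
      have hf0 : f 0 = 0 := by
        have : f 0 ≤ f a₀ := hf.monotone (Fin.zero_le _)
        rw [ha₀] at this
        exact Fin.le_zero_iff.1 this
      have hne : ∀ a : Fin n, f a.succ ≠ 0 := fun a => by
        have := hf (Fin.succ_pos a)
        rw [hf0] at this
        exact this.ne'
      have hg : StrictMono fun a : Fin n => (f a.succ).pred (hne a) := fun a b hab => by
        simpa using hf (Fin.succ_lt_succ_iff.2 hab)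
      have hfac : ∀ (i : ℕ) (x : Fin K → ℕ), (Fin.cons i x : Fin (K + 1) → ℕ) ∘ f =
          Fin.cons i (x ∘ fun a : Fin n => (f a.succ).pred (hne a)) := by
        intro i x
        funext a
        refine Fin.cases ?_ (fun a => ?_) a
        · simp [hf0]
        · conv_lhs => rw [Function.comp_apply, ← Fin.succ_pred (f a.succ) (hne a), Fin.cons_succ]
          rfl
      rw [eventually_iteratedUltrafilter_succ]
      simp only [hfac]
      exact eventually_congr (Eventually.of_forall fun i =>
        ih hg (Q := fun x => Q (Fin.cons i x)))

theorem eventually_strictMono_iteratedUltrafilter (K : ℕ) :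
    ∀ᶠ x in (iteratedUltrafilter K : Filter (Fin K → ℕ)), StrictMono x := by
  have h2 : ∀ᶠ x in (iteratedUltrafilter 2 : Filter (Fin 2 → ℕ)), x 0 < x 1 := by
    rw [eventually_iteratedUltrafilter_succ]
    refine Eventually.of_forall fun i => ?_
    rw [eventually_iteratedUltrafilter_succ]
    have : ∀ᶠ j in (hyperfilter ℕ : Filter ℕ), i < j := by
      have hle : (hyperfilter ℕ : Filter ℕ) ≤ atTop := by
        rw [← Nat.cofinite_eq_atTop]
        exact hyperfilter_le_cofinite
      exact hle (eventually_gt_atTop i)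
    exact this.mono fun j hj => Eventually.of_forall fun x => hj
  have hpair : ∀ i j : Fin K, i < j → ∀ᶠ x in (iteratedUltrafilter K : Filter (Fin K → ℕ)), x i < x j := by
    intro i j hij
    have hf : StrictMono ![i, j] := by
      rw [Fin.strictMono_iff_lt_succ]
      intro a
      fin_cases a
      exact hij
    exact (eventually_iteratedUltrafilter_comp hf (Q := fun x => x 0 < x 1)).2 h2
  exact eventually_all.2 fun i => eventually_all.2 fun j => eventually_all.2 fun hij =>
    hpair i j hij

end IteratedUltrafilter

namespace POIndisc

/-! ### Indiscernible patterns, and the counting argument. -/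

section Extraction

open FirstOrder.Language Filter

theorem le_iff_le_of_sameQFType {P : Type w'} [PartialOrder P] {n : ℕ} {i j : Fin n → P}
    (h : letI : FirstOrder.Language.order.Structure P := FirstOrder.Language.orderStructure P
      SameQFType FirstOrder.Language.order i j) (a b : Fin n) : i a ≤ i b ↔ j a ≤ j b := by
  let _ : FirstOrder.Language.order.Structure P := FirstOrder.Language.orderStructure P
  have := h (FirstOrder.Language.leSymb.formula₂ (Term.var a) (Term.var b))
    (BoundedFormula.IsAtomic.rel _ _).isQF
  rw [Formula.realize_rel₂, Formula.realize_rel₂] at this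
  exact this

variable {L : FirstOrder.Language.{u, v}} {k m : ℕ}

/-- Arbitrarily long patterns in models of `T` yield order indiscernible patterns. -/
theorem exists_indiscernible_pattern {T : L.Theory} {φ : L.Formula (Fin k ⊕ Fin m)}
    (M : ℕ → FirstOrder.Language.Theory.ModelType.{u, v, max u v w} T)
    (B : ∀ N, ℕ → Fin m → M N)
    (hB : ∀ N (s : ℕ → Prop), ∃ a : Fin k → M N, ∀ i < N, s i ↔ φ.Realize (Sum.elim a (B N i)))
    (K : ℕ) :
    ∃ (M' : FirstOrder.Language.Theory.ModelType.{u, v, max u v w} T) (c : Fin K → Fin m → M'),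
      IsPartialOrderIndiscernible L c ∧
      ∀ s : Fin K → Prop, ∃ a : Fin k → M', ∀ i, s i ↔ φ.Realize (Sum.elim a (c i)) := by
  -- The last coordinate selects the model and the others select positions. Coordinates are almost
  -- always increasing, so the positions lie below the length for which that model has all patterns.
  let V := iteratedUltrafilter (K + 1)
  let X : (Fin (K + 1) → ℕ) → Type (max u v w) := fun x => M (x (Fin.last K))
  let M' := (V : Filter (Fin (K + 1) → ℕ)).Product X
  have hM' : M' ⊨ T := (Theory.model_iff T).2 fun σ hσ =>
    (Ultraproduct.sentence_realize σ).2 (Eventually.of_forall fun x =>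
      Theory.realize_sentence_of_mem T hσ)
  let d : Fin K → Fin m → ∀ x, X x := fun r l x => B (x (Fin.last K)) (x r.castSucc) l
  let c : Fin K → Fin m → M' := fun r l => ((d r l : ∀ x, X x) : M')
  refine ⟨Theory.ModelType.of T M', c, ?_, ?_⟩
  · intro n Δ i j hi hj hqf δ _
    have hle := le_iff_le_of_sameQFType hqf
    -- `Fin K` is linearly ordered, so tuples of the same quantifier-free type are sorted by the
    -- same permutation.
    let σ := Tuple.sort i
    have hiσ : StrictMono (i ∘ σ) :=
      (Tuple.monotone_sort i).strictMono_of_injective (hi.comp σ.injective)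
    have hjσ : StrictMono (j ∘ σ) := by
      intro a b hab
      have := hiσ hab
      simp only [Function.comp_apply] at this ⊢
      rw [← not_le] at this ⊢
      rwa [← hle]
    have hred : ∀ i : Fin (n + 1) → Fin K, StrictMono (i ∘ σ) →
        (δ.Realize (fun q => c (i q.1) q.2) ↔
          ∀ᶠ y in (iteratedUltrafilter (n + 2) : Filter (Fin (n + 2) → ℕ)), δ.Realize fun q =>
            B (y (Fin.last (n + 1))) (y (σ.symm q.1).castSucc) q.2) := by
      intro i hi
      -- The sorted positions followed by the model coordinate form an increasing selection of
      -- coordinates; restricting to it removes the dependence on `i`.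
      have hf : StrictMono (Fin.snoc (α := fun _ => Fin (K + 1)) (fun a => (i (σ a)).castSucc)
          (Fin.last K)) := by
        rw [Fin.strictMono_iff_lt_succ]
        intro a
        refine Fin.lastCases ?_ (fun a => ?_) a
        · rw [Fin.succ_last, Fin.snoc_last, Fin.snoc_castSucc]
          exact Fin.castSucc_lt_last _
        · rw [Fin.succ_castSucc, Fin.snoc_castSucc, Fin.snoc_castSucc, Fin.castSucc_lt_castSucc_iff]
          exact hi (Fin.castSucc_lt_succ)
      rw [← eventually_iteratedUltrafilter_comp hf]
      refine (Ultraproduct.realize_formula_cast δ (fun q => d (i q.1) q.2)).trans ?_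
      refine eventually_congr (Eventually.of_forall fun x => ?_)
      have htransport : ∀ (y : Fin (n + 2) → ℕ) (N : ℕ) (r : Fin (n + 1) → ℕ),
          y (Fin.last (n + 1)) = N → (fun a => y (σ.symm a).castSucc) = r →
          (δ.Realize (fun q => B N (r q.1) q.2) ↔ δ.Realize fun q =>
            B (y (Fin.last (n + 1))) (y (σ.symm q.1).castSucc) q.2) := by
        rintro y _ _ rfl rfl
        exact Iff.rfl
      refine htransport _ (x (Fin.last K)) (fun a => x (i a).castSucc) (by simp) ?_
      funext a
      simp
    exact (hred i hiσ).trans (hred j hjσ).symm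
  · intro s
    refine realize_patternFormula.1 ((Ultraproduct.realize_formula_cast (patternFormula φ s)
      (fun q => d q.1 q.2)).2 ?_)
    refine (eventually_strictMono_iteratedUltrafilter (K + 1)).mono fun x hx => ?_
    refine realize_patternFormula (c := fun r : Fin K => B (x (Fin.last K)) (x r.castSucc)).2 ?_
    have hinj : Function.Injective fun r : Fin K => x r.castSucc :=
      hx.injective.comp (Fin.castSucc_injective K)
    obtain ⟨a, ha⟩ := hB (x (Fin.last K)) fun l => ∃ r : Fin K, x r.castSucc = l ∧ s r
    refine ⟨a, fun r => Iff.trans ?_ (ha _ (hx (Fin.castSucc_lt_last r)))⟩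
    exact ⟨fun h => ⟨r, rfl, h⟩, fun ⟨r', hr', h⟩ => hinj hr' ▸ h⟩

/-- The empty set is independent in any model, so sizes of independent sets can lack a maximum only
by being unbounded. -/
theorem exists_large_independent_of_not_isDependent {T : L.Theory} (hT : T.IsSatisfiable)
    {φ : L.Formula (Fin k ⊕ Fin m)} (h : ¬ IsDependent.{u, v, w} T φ) (N : ℕ) :
    ∃ (M : FirstOrder.Language.Theory.ModelType.{u, v, max u v w} T) (B : Set (Fin m → M)),
      (N : ℕ∞) ≤ B.encard ∧ IsIndependent φ B := by
  by_contra! hcon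
  let D : Set ℕ := {d : ℕ | ∃ (M : FirstOrder.Language.Theory.ModelType.{u, v, max u v w} T)
    (B : Set (Fin m → M)), B.encard = d ∧ IsIndependent φ B}
  have hne : D.Nonempty := by
    obtain ⟨M⟩ := hT
    let M' : FirstOrder.Language.Theory.ModelType.{u, v, max u v w} T :=
      Theory.ModelType.ulift.{u, v, max u v, w} M
    refine ⟨0, M', ∅, by simp, fun s => ⟨M', inferInstance, ElementaryEmbedding.refl L M',
      fun _ => Classical.arbitrary M', ?_⟩⟩
    rintro _ ⟨⟨_, hb⟩, -⟩
    exact hb.elim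
  have hbdd : BddAbove D := by
    refine ⟨N, ?_⟩
    rintro d ⟨M, B, hBd, hB⟩
    by_contra! hlt
    refine hcon M B ?_ hB
    rw [hBd]
    exact_mod_cast hlt.le
  exact h ⟨sSup D, Nat.sSup_mem hne hbdd, fun d hd => le_csSup hbdd hd⟩

theorem IsIndependent.exists_pattern {M : Type w} [L.Structure M] [Nonempty M]
    {φ : L.Formula (Fin k ⊕ Fin m)}
    {B : Set (Fin m → M)} (hB : IsIndependent φ B) {N : ℕ} (hN : (N : ℕ∞) ≤ B.encard) :
    ∃ b : ℕ → Fin m → M, ∀ s : ℕ → Prop, ∃ a : Fin k → M, ∀ i < N,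
      s i ↔ φ.Realize (Sum.elim a (b i)) := by
  classical
  obtain ⟨C, hCB, hC⟩ := Set.exists_subset_encard_eq hN
  have hCfin : C.Finite := Set.finite_of_encard_eq_coe hC
  have := hCfin.fintype
  have hcard : Fintype.card C = N := by
    rw [← Set.toFinset_card]
    rw [Set.encard_eq_coe_toFinset_card] at hC
    exact_mod_cast hC
  let ε : C ≃ Fin N := Fintype.equivFinOfCardEq hcard
  let b : Fin N → Fin m → M := fun i => (ε.symm i).1
  have hb : Function.Injective b := Subtype.val_injective.comp ε.symm.injective
  refine ⟨fun i => if hi : i < N then b ⟨i, hi⟩ else fun _ => Classical.arbitrary M, fun s => ?_⟩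
  obtain ⟨N', _, e, a', ha'⟩ := hB fun y => decide (∃ i : Fin N, b i = y ∧ s i)
  obtain ⟨a, ha⟩ := exists_forall_realize_iff_of_elementary e (φ := φ) b a'
  refine ⟨a, fun i hi => ?_⟩
  simp only [hi, dif_pos]
  rw [← ha]
  have := ha' _ ⟨⟨b ⟨i, hi⟩, hCB (ε.symm ⟨i, hi⟩).2⟩, rfl⟩
  refine Iff.trans ?_ this.symm
  simp only [decide_eq_true_eq]
  exact ⟨fun h => ⟨⟨i, hi⟩, rfl, h⟩, fun ⟨j, hj, h⟩ => by rwa [hb hj] at h⟩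

theorem exists_pow_lt_two_pow (n : ℕ) : ∃ K : ℕ, 2 ≤ K ∧ K ^ n < 2 ^ K := by
  have h := tendsto_pow_const_div_const_pow_of_one_lt n (one_lt_two : (1 : ℝ) < 2)
  obtain ⟨K, hK, hK2⟩ := ((h.eventually (gt_mem_nhds one_pos)).and (eventually_ge_atTop 2)).exists
  refine ⟨K, hK2, ?_⟩
  rw [div_lt_one (by positivity)] at hK
  exact_mod_cast hK

/-- If types over finite linearly ordered indiscernible sequences are uniformly definable, then
there are too few of them for the formula to be independent. -/
theorem isDependent_of_uniform_definition {T : L.Theory} (hT : T.IsSatisfiable)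
    {φ : L.Formula (Fin k ⊕ Fin m)} {n : ℕ} {ψ : L.Formula (Fin m ⊕ Fin n × Fin m)}
    (h : ∀ (P : Type) [PartialOrder P] [Finite P]
      (M : FirstOrder.Language.Theory.ModelType.{u, v, max u v w} T) (b : P → Fin m → M),
      IsPartialOrderIndiscernible L b → (Set.range b).Nontrivial →
      ∀ p ∈ typeSpace φ (Set.range b), ∃ i : Fin n → P, ∀ j : P,
        (b j, true) ∈ p ↔ ψ.Realize (Sum.elim (b j) fun q => b (i q.1) q.2)) :
    IsDependent.{u, v, w} T φ := by
  by_contra hdep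
  choose M B hcard hind using exists_large_independent_of_not_isDependent.{u, v, w} hT hdep
  choose b hb using fun N => (hind N).exists_pattern (hcard N)
  obtain ⟨K, hK2, hK⟩ := exists_pow_lt_two_pow n
  obtain ⟨M', c, hc, hpat⟩ := exists_indiscernible_pattern.{u, v, w} M b hb K
  have hinj : Function.Injective c := by
    intro i j hij
    obtain ⟨a, ha⟩ := hpat fun l => l = i
    have h1 := (ha i).1 rfl
    rw [hij] at h1
    exact ((ha j).2 h1).symm
  have hnt : (Set.range c).Nontrivial :=
    ⟨c ⟨0, by omega⟩, ⟨_, rfl⟩, c ⟨1, by omega⟩, ⟨_, rfl⟩, fun he => by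
      simpa using hinj he⟩
  have hdef : ∀ s : Fin K → Bool, ∃ i : Fin n → Fin K, ∀ j : Fin K,
      s j = true ↔ ψ.Realize (Sum.elim (c j) fun q => c (i q.1) q.2) := by
    intro s
    obtain ⟨i, hi⟩ := h (Fin K) M' c hc hnt (Set.range fun j => (c j, s j)) (by
      refine ⟨fun y => ⟨?_, ?_⟩, ?_⟩
      · rintro ⟨t, j, hj⟩
        exact ⟨j, congrArg Prod.fst hj⟩
      · rintro ⟨j, rfl⟩
        exact ⟨s j, j, rfl⟩
      · obtain ⟨a, ha⟩ := hpat fun j => s j = true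
        refine ⟨M', inferInstance, ElementaryEmbedding.refl L M', a, ?_⟩
        rintro _ ⟨j, rfl⟩
        exact (ha j).symm)
    refine ⟨i, fun j => Iff.trans ?_ (hi j)⟩
    constructor
    · exact fun hs => ⟨j, Prod.ext rfl hs⟩
    · rintro ⟨j', hj'⟩
      obtain ⟨h1, h2⟩ := Prod.ext_iff.1 hj'
      rw [← hinj h1]
      exact h2
  choose i hi using hdef
  -- The pattern `s` is recovered from its defining parameters, so `2 ^ K ≤ K ^ n`.
  have hi_inj : Function.Injective i := by
    intro s s' hss
    funext j
    exact Bool.eq_iff_iff.2 ((hi s j).trans (by rw [hss]; exact (hi s' j).symm))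
  have := Fintype.card_le_of_injective i hi_inj
  simp only [Fintype.card_fun, Fintype.card_bool, Fintype.card_fin] at this
  omega

end Extraction

end POIndisc

theorem theorem1p1 {L : FirstOrder.Language.{u, v}} (T : L.Theory) (hT : T.IsComplete) {k m : ℕ}
    (φ : L.Formula (Fin k ⊕ Fin m)) :
    POIndisc.IsDependent.{u, v, w} T φ ↔
      ∃ (n : ℕ) (ψ : L.Formula (Fin m ⊕ Fin n × Fin m)),
        ∀ (P : Type) [PartialOrder P] [Finite P]
          (M : FirstOrder.Language.Theory.ModelType.{u, v, max u v w} T) (b : P → Fin m → M),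
          POIndisc.IsPartialOrderIndiscernible L b → (Set.range b).Nontrivial →
          ∀ p ∈ POIndisc.typeSpace φ (Set.range b), ∃ i : Fin n → P, ∀ j : P,
            (b j, true) ∈ p ↔ ψ.Realize (Sum.elim (b j) fun q => b (i q.1) q.2) := by
  constructor
  · intro h
    obtain ⟨n, ψ, hψ⟩ := POIndisc.exists_uniform_definition_of_isDependent h
    exact ⟨n, ψ, fun P _ _ M b _ hnt p hp => hψ P M b hnt p hp⟩
  · rintro ⟨n, ψ, h⟩
    exact POIndisc.isDependent_of_uniform_definition hT.1 h
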